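/- Let $(X,Y)$ have law $P$ on $\mathbb{R}^p\times\mathbb{R}$, and let $\mathcal{H}_0\subseteq[p]$ be the set of nulls, i.e. of the $j$ with $Y\perp X_j\mid X_{-j}$ under $P$. Let $\mathbf{X}\in\mathbb{R}^{n\times p}$, $\mathbf{Y}\in\mathbb{R}^n$ consist of $n$ i.i.d. samples from $P$. Let $\kappa$ be a conditional distribution of a knockoff matrix $\tilde{\mathbf{X}}$ given $\mathbf{X}$ such that, for every $j\in[p]$, exchanging the $j$-th columns of $\mathbf{X}$ and $\tilde{\mathbf{X}}$ does not change the joint law of $(\mathbf{X},\tilde{\mathbf{X}})$. Given $(\mathbf{X},\mathbf{Y})$, draw $\tilde{\mathbf{X}}^{(1)},\dots,\tilde{\mathbf{X}}^{(M)}$ i.i.d. from $\kappa(\cdot\mid\mathbf{X})$, $M\ge 1$, and set $W^{(m)}=\mathcal{W}([\mathbf{X},\tilde{\mathbf{X}}^{(m)}],\mathbf{Y})\in\mathbb{R}^p$, where $\mathcal{W}$ is a measurable map such that exchanging the $j$-th columns of its two matrix arguments flips the sign of the $j$-th output and leaves the other outputs unchanged. Fix $\alpha_{\rm kn},\alpha_{\rm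 ebh}\in(0,1)$ and fixed side information $u\in\mathbb{R}_+^p$ (that is, $u_j\ge 0$). Consider two choices of e-values. Weighted version. Let $T^{(m)}$ be the smallest $t>0$ in $\{|W^{(m)}_1|,\dots,|W^{(m)}_p|\}$ such that $$\frac{1+\#\{j:W^{(m)}_j\le -t\}}{\#\{j:W^{(m)}_j\ge t\}}\le\alpha_{\rm kn}\quad\text{or}\quad \#\{j:W_j^{(m)}\ge t\}<1/\alpha_{\rm kn},$$ and $T^{(m)}=\infty$ if there is none; with $0/0=0$, let $$e_j^{(m)}=\frac{p\,u_j\,\mathbf{1}\{W^{(m)}_j\ge T^{(m)}\}}{u_j+\sum_{k\in[p]}u_k\,\mathbf{1}\{W^{(m)}_k\le -T^{(m)}\}}.$$ Adaptive version. In run $m$ the features are screened one at a time; the next feature to be screened is chosen by an arbitrary (measurable) rule that sees $u$, the set of the features screened so far, their statistics $W^{(m)}_j$, and only the magnitudes $|W^{(m)}_j|$ of the unscreened features. For $k\in\{0,\dots,p\}$ let $P_m(k)$ and $N_m(k)$ be the sets of the features not yet screened after $k$ steps with $W^{(m)}_j>0$ and $W^{(m)}_j<0$, respectively. Let $$T^{(m)}=\inf\Big\{k\in\{0,\dots,p\}:\frac{1+|N_m(k)|}{|P_m(k)|\vee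 1}\le\alpha_{\rm kn}\Big\},\qquad e_j^{(m)}=\frac{p\,\mathbf{1}\{j\in P_m(T^{(m)})\}}{1+|N_m(T^{(m)})|},$$ where $e_j^{(m)}=0$ for all $j$ if the infimum is over the empty set. In either version let $e_j^{\rm avg}=\frac1M\sum_{m=1}^M e_j^{(m)}$, let $e^{\rm avg}_{(1)}\ge\dots\ge e^{\rm avg}_{(p)}$ be their order statistics, let $\hat k=\max\{k\in[p]:e^{\rm avg}_{(k)}\ge p/(\alpha_{\rm ebh}k)\}$ ($\hat k=0$ if there is no such $k$), and select $\mathcal{S}=\{j\in[p]:e_j^{\rm avg}\ge p/(\alpha_{\rm ebh}\hat k)\}$ ($\mathcal{S}=\emptyset$ if $\hat k=0$). Then, in both versions, $$\mathrm{FDR}=\mathbb{E}\left[\frac{|\mathcal{S}\cap\mathcal{H}_0|}{|\mathcal{S}|\vee 1}\right]\le\alpha_{\rm ebh}.$$ -/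

import Mathlib

open MeasureTheory ProbabilityTheory
open scoped ENNReal

noncomputable section

namespace DerandKnockoffs

/-! ### Model-X data and null hypotheses -/

/-- An `n × p` design matrix: row `i` is the `i`-th sample of the `p` covariates. -/
abbrev Design (n p : ℕ) : Type := Fin n → Fin p → ℝ

/-- A data set of `n` labelled samples `(X_i, Y_i)`. -/
abbrev Data (n p : ℕ) : Type := Fin n → (Fin p → ℝ) × ℝ

/-- The covariate matrix `𝐗` of a data set. -/
def Data.X {n p : ℕ} (d : Data n p) : Design n p := fun i => (d i).1

/-- The response vector `𝐘` of a data set. -/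
def Data.Y {n p : ℕ} (d : Data n p) : Fin n → ℝ := fun i => (d i).2

theorem Data.measurable_X {n p : ℕ} : Measurable (Data.X : Data n p → Design n p) := by
  unfold Data.X
  fun_prop

/-- The covariates other than the `j`-th one, `X_{-j}`. -/
def covariatesExcept {p : ℕ} (j : Fin p) (z : (Fin p → ℝ) × ℝ) : {k : Fin p // k ≠ j} → ℝ :=
  fun k => z.1 k

theorem measurable_covariatesExcept {p : ℕ} (j : Fin p) : Measurable (covariatesExcept j) := by
  unfold covariatesExcept
  fun_prop

/-- The null hypothesis `H_j`: under the law `P` of `(X, Y)`, the response `Y` is conditionally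
independent of `X_j` given `X_{-j}`. -/
def IsNull {p : ℕ} (P : Measure ((Fin p → ℝ) × ℝ)) [IsFiniteMeasure P] (j : Fin p) : Prop :=
  CondIndepFun (MeasurableSpace.comap (covariatesExcept j) inferInstance)
    (measurable_covariatesExcept j).comap_le
    (fun z : (Fin p → ℝ) × ℝ => z.2) (fun z : (Fin p → ℝ) × ℝ => z.1 j) P

open Classical in
/-- The set `𝓗₀` of null features. -/
def nulls {p : ℕ} (P : Measure ((Fin p → ℝ) × ℝ)) [IsFiniteMeasure P] : Finset (Fin p) :=
  Finset.univ.filter (IsNull P)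

/-- The law of `n` i.i.d. samples from `P`. -/
def dataLaw {p : ℕ} (n : ℕ) (P : Measure ((Fin p → ℝ) × ℝ)) : Measure (Data n p) :=
  Measure.pi fun _ : Fin n => P

/-! ### Knockoff copies and feature importance statistics -/

/-- Exchange the `j`-th columns of the two matrices. -/
def swapColumn {n p : ℕ} (j : Fin p) (A : Design n p × Design n p) : Design n p × Design n p :=
  (fun i k => if k = j then A.2 i k else A.1 i k,
   fun i k => if k = j then A.1 i k else A.2 i k)

/-- `κ` is a valid conditional distribution of the knockoff matrix given the covariate matrix,
whose law is `μ`: for each `j`, exchanging `𝐗_j` and `𝐗̃_j` does not change the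
joint law of `(𝐗, 𝐗̃)`. -/
def PairwiseExchangeable {n p : ℕ} (μ : Measure (Design n p))
    (κ : Kernel (Design n p) (Design n p)) : Prop :=
  ∀ j : Fin p, (μ ⊗ₘ κ).map (swapColumn j) = μ ⊗ₘ κ

/-- Given the covariate matrix, draw `M` knockoff matrices independently from `κ`. -/
def knockoffCopies {n p : ℕ} (M : ℕ) (κ : Kernel (Design n p) (Design n p)) [IsMarkovKernel κ] :
    Kernel (Design n p) (Fin M → Design n p) where
  toFun x := Measure.pi fun _ : Fin M => κ x
  measurable' := by
    refine Measurable.measure_of_isPiSystem_of_isProbabilityMeasure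
      generateFrom_pi.symm isPiSystem_pi ?_
    rintro _ ⟨s, hs, rfl⟩
    simp only [Measure.pi_pi]
    exact Finset.measurable_prod _ fun m _ => κ.measurable_coe (hs m (Set.mem_univ m))

/-- The joint law of the data `(𝐗, 𝐘)`, which are `n` i.i.d. samples from `P`, and of `M`
knockoff matrices drawn i.i.d. from `κ(𝐗)`, conditionally on the data. In particular the
knockoffs are generated without looking at `𝐘`. -/
def experimentLaw {p : ℕ} (n M : ℕ) (P : Measure ((Fin p → ℝ) × ℝ))
    (κ : Kernel (Design n p) (Design n p)) [IsMarkovKernel κ] :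
    Measure (Data n p × (Fin M → Design n p)) :=
  dataLaw n P ⊗ₘ ((knockoffCopies M κ).comap Data.X Data.measurable_X)

/-- A rule computing feature importance statistics from `([𝐗, 𝐗̃], 𝐘)`: exchanging `𝐗_j` and
`𝐗̃_j` flips the sign of the `j`-th statistic and leaves the other ones unchanged. -/
structure ImportanceRule (n p : ℕ) where
  /-- the statistics `W` as a function of `[𝐗, 𝐗̃]` and `𝐘` -/
  stat : Design n p × Design n p → (Fin n → ℝ) → Fin p → ℝ
  measurable_stat : Measurable fun a : (Design n p × Design n p) × (Fin n → ℝ) => stat a.1 a.2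
  stat_swapColumn : ∀ (j : Fin p) (A : Design n p × Design n p) (y : Fin n → ℝ) (k : Fin p),
    stat (swapColumn j A) y k = if k = j then -stat A y k else stat A y k

/-- The statistics `W^{(m)}` computed with the `m`-th knockoff matrix. -/
def ImportanceRule.run {n p M : ℕ} (𝒲 : ImportanceRule n p)
    (ω : Data n p × (Fin M → Design n p)) (m : Fin M) : Fin p → ℝ :=
  𝒲.stat (ω.1.X, ω.2 m) ω.1.Y

/-! ### The e-BH procedure and the false discovery rate -/

/-- The `(k+1)`-th largest of the numbers `e_1, …, e_p`, for `k = 0, …, p - 1`. -/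
def kthLargest {p : ℕ} (e : Fin p → ℝ) (k : Fin p) : ℝ := e (Tuple.sort e k.rev)

/-- `k̂ = max {k ∈ [p] : e_(k) ≥ p / (α k)}`, and `k̂ = 0` if there is no such `k`. -/
def ebhCount {p : ℕ} (α : ℝ) (e : Fin p → ℝ) : ℕ :=
  (Finset.univ.filter fun k : Fin p => (p : ℝ) / (α * ((k : ℕ) + 1 : ℝ)) ≤ kthLargest e k).sup
    fun k => (k : ℕ) + 1

open Classical in
/-- The set selected by the e-BH procedure at level `α`; it is empty if `k̂ = 0`. -/
def ebhSelect {p : ℕ} (α : ℝ) (e : Fin p → ℝ) : Finset (Fin p) :=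
  Finset.univ.filter fun j => 0 < ebhCount α e ∧ (p : ℝ) / (α * (ebhCount α e : ℝ)) ≤ e j

/-- The false discovery proportion `|S ∩ 𝓗₀| / (|S| ∨ 1)`. -/
def fdp {p : ℕ} (S H₀ : Finset (Fin p)) : ℝ := ((S ∩ H₀).card : ℝ) / (max S.card 1 : ℕ)

/-- The false discovery rate of a random selected set `S`, i.e. the expectation of the
(nonnegative) false discovery proportion. -/
def fdr {Ω : Type*} [MeasurableSpace Ω] {p : ℕ} (μ : Measure Ω) (S : Ω → Finset (Fin p))
    (H₀ : Finset (Fin p)) : ℝ≥0∞ :=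
  ∫⁻ ω, ENNReal.ofReal (fdp (S ω) H₀) ∂μ

/-- Average the e-values of the `M` runs and apply e-BH at level `α`; here `eval w j` is the
e-value of feature `j` in a run with feature importance statistics `w`. -/
def derandomizedSelect {n p M : ℕ} (α : ℝ) (𝒲 : ImportanceRule n p)
    (eval : (Fin p → ℝ) → Fin p → ℝ) (ω : Data n p × (Fin M → Design n p)) : Finset (Fin p) :=
  ebhSelect α fun j => (1 / (M : ℝ)) * ∑ m : Fin M, eval (𝒲.run ω m) j

/-! ### The weighted e-values -/

/-- The number of features with `w_j ≥ t`. -/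
def countPos {p : ℕ} (w : Fin p → ℝ) (t : ℝ) : ℕ := (Finset.univ.filter fun j => t ≤ w j).card

/-- The number of features with `w_j ≤ -t`. -/
def countNeg {p : ℕ} (w : Fin p → ℝ) (t : ℝ) : ℕ := (Finset.univ.filter fun j => w j ≤ -t).card

open Classical in
/-- The knockoff threshold with early stopping: the smallest `t > 0` among the magnitudes
`|w_1|, …, |w_p|` with `(1 + #{w_j ≤ -t}) / #{w_j ≥ t} ≤ α` or `#{w_j ≥ t} < 1 / α`, and `∞` if
there is none. The ratio is written without division; it counts as `∞` if its denominator
vanishes. -/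
def knockoffThreshold {p : ℕ} (α : ℝ) (w : Fin p → ℝ) : WithTop ℝ :=
  ((Finset.univ.image fun j => |w j|).filter fun t => 0 < t ∧
    ((1 + countNeg w t : ℝ) ≤ α * countPos w t ∨ (countPos w t : ℝ) < 1 / α)).min

open Classical in
/-- The weighted e-value `p u_j 1{w_j ≥ T} / (u_j + ∑_k u_k 1{w_k ≤ -T})`, with `0 / 0 = 0`.
The condition `w_k ≤ -T` is written as `T ≤ -w_k`, since `T` may be `∞`. -/
def weightedEValue {p : ℕ} (α : ℝ) (u : Fin p → ℝ) (w : Fin p → ℝ) (j : Fin p) : ℝ :=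
  ((p : ℝ) * u j * if knockoffThreshold α w ≤ ((w j : ℝ) : WithTop ℝ) then 1 else 0) /
    (u j + ∑ k : Fin p, u k * if knockoffThreshold α w ≤ ((-w k : ℝ) : WithTop ℝ) then 1 else 0)

/-! ### Adaptive knockoffs -/

/-- The partially masked statistics: the value `w_j` for the features already screened, and only
the magnitude `|w_j|` for the other ones. -/
def masked {p : ℕ} (D : Finset (Fin p)) (w : Fin p → ℝ) : Fin p → ℝ :=
  fun j => if j ∈ D then w j else |w j|

/-- An arbitrary rule choosing the feature to be screened next from the side information, the set
of the features already screened and the partially masked statistics. (The order in which the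
earlier features were screened can be recovered from these.) -/
structure ScreeningRule (p : ℕ) where
  /-- the next feature, given side information, screened features and masked statistics -/
  next : (Fin p → ℝ) → Finset (Fin p) → (Fin p → ℝ) → Fin p
  next_notMem : ∀ u D v, D ≠ Finset.univ → next u D v ∉ D
  measurable_next : ∀ u D, Measurable (next u D)

namespace ScreeningRule

variable {p : ℕ} (r : ScreeningRule p) (u w : Fin p → ℝ)

/-- The set of the features screened in the first `k` steps. -/
def screened : ℕ → Finset (Fin p)
  | 0 => ∅
  | k + 1 => insert (r.next u (screened k) (masked (screened k) w)) (screened k)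

/-- `P(k)`: the unscreened features with positive statistics after `k` steps. -/
def unscreenedPos (k : ℕ) : Finset (Fin p) :=
  Finset.univ.filter fun j => j ∉ r.screened u w k ∧ 0 < w j

/-- `N(k)`: the unscreened features with negative statistics after `k` steps. -/
def unscreenedNeg (k : ℕ) : Finset (Fin p) :=
  Finset.univ.filter fun j => j ∉ r.screened u w k ∧ w j < 0

open Classical in
/-- The stopping time `inf {k ∈ {0, …, p} : (1 + |N(k)|) / (|P(k)| ∨ 1) ≤ α}`, which is `∞` if the
set is empty. -/
def stoppingTime (α : ℝ) : WithTop ℕ :=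
  ((Finset.range (p + 1)).filter fun k =>
    (1 + (r.unscreenedNeg u w k).card : ℝ) /
      (max (r.unscreenedPos u w k).card 1 : ℕ) ≤ α).min

open Classical in
/-- The e-value `p 1{j ∈ P(T)} / (1 + |N(T)|)`. If `T = ∞`, all features have been screened and
none is selected, so that the e-value is `0`. -/
def eValue (α : ℝ) (j : Fin p) : ℝ :=
  match r.stoppingTime u w α with
  | ⊤ => 0
  | (k : ℕ) => ((p : ℝ) * if j ∈ r.unscreenedPos u w k then 1 else 0) /
      (1 + (r.unscreenedNeg u w k).card : ℝ)

end ScreeningRule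

end DerandKnockoffs

end

open DerandKnockoffs

/-! e-BH satisfies the deterministic bound FDP ≤ (α/p) ∑ e_j, summed over the nulls
(`fdp_ebhSelect_le`). Averaging over runs is linear, so it suffices that in each single run the
expected e-values of the nulls sum to at most p. Dependence between the runs plays no role.

For a null j, Y given X has a law that ignores X_j, and the knockoffs are drawn without Y.
Exchanging the j-th columns therefore preserves the law of ([X, X̃], Y), and W has the same law as W
with its j-th sign flipped (`lintegral_run_flipSign`). So E e_j(W) = E e_j(flip_j W), and the claim
reduces to a pointwise inequality: ∑_j e_j(flip_j w) ≤ p for every w. No martingale is involved, and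
only one sign is flipped at a time.

For the pointwise inequality, let J be the set of j whose term is nonzero. Each such w_j is negative
and still counted at the stopping threshold (or time) of flip_j w. Flipping any one of these signs
moves one feature from the negative to the positive count, so the stopping condition cannot tell
which one was flipped, and all j in J stop at the same place. The denominators are then at least a
common total over J, and the terms sum to at most p (`sum_weightedEValue_flipSign_le`,
`ScreeningRule.sum_eValue_flipSign_le`). -/

namespace DerandKnockoffs

/-! ### Deterministic bound for e-BH -/

section EBH

variable {p : ℕ}

/-- `Tuple.sort` is increasing, so the k + 1 sorted positions from `k.rev` upwards carry values at
least `kthLargest e k`; ties can only add more. -/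
theorem succ_le_card_kthLargest_le (e : Fin p → ℝ) (k : Fin p) :
    (k : ℕ) + 1 ≤ (Finset.univ.filter fun j => kthLargest e k ≤ e j).card := by
  have hsub : (Finset.Ici k.rev).map (Tuple.sort e).toEmbedding ⊆
      Finset.univ.filter fun j => kthLargest e k ≤ e j := by
    intro j hj
    obtain ⟨i, hi, rfl⟩ := Finset.mem_map.1 hj
    simp only [Finset.mem_filter, Finset.mem_univ, true_and]
    exact Tuple.monotone_sort e (Finset.mem_Ici.1 hi)
  have hcard := Finset.card_le_card hsub
  rw [Finset.card_map, Fin.card_Ici, Fin.val_rev] at hcard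
  omega

theorem ebhCount_le_card_ebhSelect {α : ℝ} (e : Fin p → ℝ) :
    ebhCount α e ≤ (ebhSelect α e).card := by
  rcases Nat.eq_zero_or_pos (ebhCount α e) with h0 | hpos
  · simp [h0]
  obtain ⟨k, hk, hke⟩ := Finset.exists_mem_eq_sup
    (Finset.univ.filter fun k : Fin p => (p : ℝ) / (α * ((k : ℕ) + 1 : ℝ)) ≤ kthLargest e k)
    (by
      rw [Finset.nonempty_iff_ne_empty]
      intro h
      simp [ebhCount, h] at hpos) (fun k => (k : ℕ) + 1)
  have hcount : ebhCount α e = (k : ℕ) + 1 := hke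
  rw [hcount]
  refine (succ_le_card_kthLargest_le e k).trans (Finset.card_le_card fun j hj => ?_)
  simp only [Finset.mem_filter, Finset.mem_univ, true_and] at hk hj
  simp only [ebhSelect, Finset.mem_filter, Finset.mem_univ, true_and, hcount]
  refine ⟨Nat.succ_pos _, ?_⟩
  push_cast
  exact hk.trans hj

/-- The false discovery proportion of e-BH is controlled by the sum of the null e-values. -/
theorem fdp_ebhSelect_le {α : ℝ} (hα : 0 < α) (e : Fin p → ℝ) (he : ∀ j, 0 ≤ e j)
    (H₀ : Finset (Fin p)) :
    fdp (ebhSelect α e) H₀ ≤ α / p * ∑ j ∈ H₀, e j := by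
  have hnn : 0 ≤ α / p * ∑ j ∈ H₀, e j :=
    mul_nonneg (by positivity) (Finset.sum_nonneg fun j _ => he j)
  rcases (ebhSelect α e).eq_empty_or_nonempty with h0 | hne
  · simpa [fdp, h0] using hnn
  obtain ⟨j₀, hj₀⟩ := hne
  have hp : (0 : ℝ) < p := by exact_mod_cast j₀.pos
  have hk : 0 < ebhCount α e := by
    simp only [ebhSelect, Finset.mem_filter] at hj₀
    exact hj₀.2.1
  have hkr : (0 : ℝ) < ebhCount α e := by exact_mod_cast hk
  have hcard : 1 ≤ (ebhSelect α e).card := Finset.card_pos.2 ⟨j₀, hj₀⟩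
  have hle : (ebhCount α e : ℝ) ≤ (ebhSelect α e).card := by
    exact_mod_cast ebhCount_le_card_ebhSelect e
  have hsum : ((ebhSelect α e ∩ H₀).card : ℝ) * (p / (α * ebhCount α e)) ≤ ∑ j ∈ H₀, e j := by
    rw [← nsmul_eq_mul]
    refine (Finset.card_nsmul_le_sum _ e _ fun j hj => ?_).trans
      (Finset.sum_le_sum_of_subset_of_nonneg Finset.inter_subset_right fun j _ _ => he j)
    have := (Finset.mem_inter.1 hj).1
    simp only [ebhSelect, Finset.mem_filter] at this
    exact this.2.2
  rw [fdp, max_eq_left hcard]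
  -- Replacing |S| by the smaller k̂ turns 1/k̂ into α/p times the selection threshold, which every
  -- selected e-value exceeds or equals.
  calc ((ebhSelect α e ∩ H₀).card : ℝ) / (ebhSelect α e).card
      ≤ (ebhSelect α e ∩ H₀).card / ebhCount α e := by gcongr
    _ = α / p * ((ebhSelect α e ∩ H₀).card * (p / (α * ebhCount α e))) := by field_simp
    _ ≤ _ := by gcongr

end EBH

/-! ### Sign flips -/

section Flip

variable {p : ℕ}

/-- Flip the sign of the `j`-th coordinate. -/
def flipSign (j : Fin p) (w : Fin p → ℝ) : Fin p → ℝ := fun k => if k = j then -w k else w k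

@[simp] theorem flipSign_self (j : Fin p) (w : Fin p → ℝ) : flipSign j w j = -w j := by
  simp [flipSign]

theorem flipSign_of_ne {j k : Fin p} (h : k ≠ j) (w : Fin p → ℝ) : flipSign j w k = w k := by
  simp [flipSign, h]

@[simp] theorem abs_flipSign (j : Fin p) (w : Fin p → ℝ) (k : Fin p) :
    |flipSign j w k| = |w k| := by
  unfold flipSign; split_ifs <;> simp

@[simp] theorem flipSign_flipSign (j : Fin p) (w : Fin p → ℝ) : flipSign j (flipSign j w) = w := by
  funext k
  unfold flipSign
  split_ifs <;> simp

theorem measurable_flipSign (j : Fin p) : Measurable (flipSign j) := by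
  refine measurable_pi_lambda _ fun k => ?_
  by_cases h : k = j <;> simp only [flipSign, h, if_true, if_false] <;> fun_prop

end Flip

/-! ### Weighted e-values: pointwise inequality and measurability -/

section Weighted

variable {p : ℕ} {α : ℝ} {u w : Fin p → ℝ}

theorem countPos_flipSign {j : Fin p} {t : ℝ} (ht : 0 < t) (hj : t ≤ -w j) :
    countPos (flipSign j w) t = countPos w t + 1 := by
  have h : (Finset.univ.filter fun k => t ≤ flipSign j w k) =
      insert j (Finset.univ.filter fun k => t ≤ w k) := by
    ext k
    by_cases hk : k = j
    · subst hk; simpa using hj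
    · simp [flipSign_of_ne hk, hk]
  rw [countPos, h, Finset.card_insert_of_notMem, countPos]
  simp only [Finset.mem_filter, Finset.mem_univ, true_and, not_le]
  linarith

theorem countNeg_flipSign {j : Fin p} {t : ℝ} (ht : 0 < t) (hj : t ≤ -w j) :
    countNeg (flipSign j w) t + 1 = countNeg w t := by
  have h : (Finset.univ.filter fun k => w k ≤ -t) =
      insert j (Finset.univ.filter fun k => flipSign j w k ≤ -t) := by
    ext k
    by_cases hk : k = j
    · subst hk; simp; linarith
    · simp [flipSign_of_ne hk, hk]
  rw [countNeg, countNeg, h, Finset.card_insert_of_notMem]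
  simp only [Finset.mem_filter, Finset.mem_univ, true_and, not_le, flipSign_self]
  linarith

/-- The stopping condition of the knockoff threshold at level `t`. -/
def StopAt (α : ℝ) (w : Fin p → ℝ) (t : ℝ) : Prop :=
  0 < t ∧ ((1 + countNeg w t : ℝ) ≤ α * countPos w t ∨ (countPos w t : ℝ) < 1 / α)

theorem knockoffThreshold_le_coe_iff {a : ℝ} :
    knockoffThreshold α w ≤ (a : WithTop ℝ) ↔ ∃ i, StopAt α w |w i| ∧ |w i| ≤ a := by
  constructor
  · intro h
    obtain ⟨t, ht⟩ := WithTop.ne_top_iff_exists.1 (ne_top_of_le_ne_top WithTop.coe_ne_top h)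
    have hmem := Finset.mem_of_min ht.symm
    simp only [Finset.mem_filter, Finset.mem_image, Finset.mem_univ, true_and] at hmem
    obtain ⟨⟨i, rfl⟩, hi⟩ := hmem
    rw [← ht] at h
    exact ⟨i, hi, WithTop.coe_le_coe.1 h⟩
  · rintro ⟨i, hi, hia⟩
    refine (Finset.min_le (a := |w i|) ?_).trans (WithTop.coe_le_coe.2 hia)
    simp only [Finset.mem_filter, Finset.mem_image, Finset.mem_univ, true_and]
    exact ⟨⟨i, rfl⟩, hi⟩

theorem exists_of_knockoffThreshold_eq_coe {t : ℝ} (ht : knockoffThreshold α w = t) :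
    StopAt α w t ∧ ∃ i, |w i| = t := by
  have hmem := Finset.mem_of_min ht
  simp only [Finset.mem_filter, Finset.mem_image, Finset.mem_univ, true_and] at hmem
  exact ⟨hmem.2, hmem.1⟩

/-- Magnitudes ignore signs, and flipping j or k shifts both counts at t by the same unit, so t is a
stopping level for both flipped vectors. -/
theorem knockoffThreshold_flipSign_le_of_eq_coe {j k : Fin p} {t : ℝ}
    (ht : knockoffThreshold α (flipSign j w) = t) (hj : t ≤ -w j) (hk : t ≤ -w k) :
    knockoffThreshold α (flipSign k w) ≤ t := by
  obtain ⟨⟨h0, hs⟩, i, hi⟩ := exists_of_knockoffThreshold_eq_coe ht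
  rw [abs_flipSign] at hi
  refine knockoffThreshold_le_coe_iff.2 ⟨i, ?_, ?_⟩
  · rw [abs_flipSign, hi]
    refine ⟨h0, ?_⟩
    have hN : countNeg (flipSign k w) t = countNeg (flipSign j w) t := by
      have h1 := countNeg_flipSign h0 hj
      have h2 := countNeg_flipSign h0 hk
      omega
    have hP : countPos (flipSign k w) t = countPos (flipSign j w) t := by
      rw [countPos_flipSign h0 hj, countPos_flipSign h0 hk]
    rwa [hN, hP]
  · rw [abs_flipSign, hi]

/-- At the smaller of the two thresholds both features are still counted as negative in w, so the
previous lemma bounds the larger threshold by the smaller. -/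
theorem knockoffThreshold_flipSign_eq {j k : Fin p}
    (hj : knockoffThreshold α (flipSign j w) ≤ ((-w j : ℝ) : WithTop ℝ))
    (hk : knockoffThreshold α (flipSign k w) ≤ ((-w k : ℝ) : WithTop ℝ)) :
    knockoffThreshold α (flipSign j w) = knockoffThreshold α (flipSign k w) := by
  obtain ⟨s, hs⟩ := WithTop.ne_top_iff_exists.1 (ne_top_of_le_ne_top WithTop.coe_ne_top hj)
  obtain ⟨t, ht⟩ := WithTop.ne_top_iff_exists.1 (ne_top_of_le_ne_top WithTop.coe_ne_top hk)
  rw [← hs, WithTop.coe_le_coe] at hj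
  rw [← ht, WithTop.coe_le_coe] at hk
  rcases le_total s t with h | h
  · have := knockoffThreshold_flipSign_le_of_eq_coe hs.symm hj (h.trans hk)
    rw [← ht, WithTop.coe_le_coe] at this
    rw [← hs, ← ht, le_antisymm h this]
  · have := knockoffThreshold_flipSign_le_of_eq_coe ht.symm hk (h.trans hj)
    rw [← hs, WithTop.coe_le_coe] at this
    rw [← hs, ← ht, le_antisymm h this]

theorem weightedEValue_nonneg (hu : ∀ j, 0 ≤ u j) (j : Fin p) : 0 ≤ weightedEValue α u w j := by
  unfold weightedEValue
  refine div_nonneg (mul_nonneg (mul_nonneg (Nat.cast_nonneg p) (hu j)) (by split_ifs <;> simp))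
    (add_nonneg (hu j) (Finset.sum_nonneg fun k _ => mul_nonneg (hu k) (by split_ifs <;> simp)))

theorem sum_weightedEValue_flipSign_le (hu : ∀ j, 0 ≤ u j) :
    ∑ j, weightedEValue α u (flipSign j w) j ≤ p := by
  classical
  set J : Finset (Fin p) := Finset.univ.filter fun j =>
    knockoffThreshold α (flipSign j w) ≤ ((-w j : ℝ) : WithTop ℝ) 
  have hmem : ∀ j, j ∈ J ↔ knockoffThreshold α (flipSign j w) ≤ ((-w j : ℝ) : WithTop ℝ) :=
    fun j => Finset.mem_filter_univ j
  have hzero : ∀ j ∉ J, weightedEValue α u (flipSign j w) j = 0 := by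
    intro j hj
    have : ¬ knockoffThreshold α (flipSign j w) ≤ ((flipSign j w j : ℝ) : WithTop ℝ) := by
      rwa [flipSign_self, ← hmem]
    rw [weightedEValue, if_neg this, mul_zero, zero_div]
  rw [← Finset.sum_subset J.subset_univ fun j _ hj => hzero j hj]
  have hval : ∀ j ∈ J, weightedEValue α u (flipSign j w) j ≤ p * (u j / ∑ k ∈ J, u k) := by
    intro j hj
    have hle : knockoffThreshold α (flipSign j w) ≤ ((-w j : ℝ) : WithTop ℝ) :=
      (hmem j).1 hj
    obtain ⟨t, ht⟩ := WithTop.ne_top_iff_exists.1 (ne_top_of_le_ne_top WithTop.coe_ne_top hle)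
    have h0 := (exists_of_knockoffThreshold_eq_coe ht.symm).1.1
    -- The leading u_j stands in for j, which has left the negative side. Every other k in J keeps
    -- its w_k and shares the threshold, so its indicator is 1.
    have hden : ∑ k ∈ J, u k ≤ u j + ∑ k, u k *
        if knockoffThreshold α (flipSign j w) ≤ ((-flipSign j w k : ℝ) : WithTop ℝ)
          then 1 else 0 := by
      rw [← Finset.add_sum_erase J u hj]
      gcongr
      refine (Finset.sum_le_sum fun k hk => ?_).trans
        (Finset.sum_le_sum_of_subset_of_nonneg (J.erase j).subset_univ fun k _ _ =>
          mul_nonneg (hu k) (by split_ifs <;> simp))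
      obtain ⟨hkj, hkJ⟩ := Finset.mem_erase.1 hk
      have hk' : knockoffThreshold α (flipSign k w) ≤ ((-w k : ℝ) : WithTop ℝ) :=
        (hmem k).1 hkJ
      rw [flipSign_of_ne hkj, knockoffThreshold_flipSign_eq hle hk', if_pos hk', mul_one]
    -- If u_j = 0 both sides vanish, including the 0/0 case; otherwise the total weight of J is
    -- positive and can be divided by.
    rcases (hu j).eq_or_lt with h | h
    · simp [weightedEValue, ← h]
    · have hpos : 0 < ∑ k ∈ J, u k :=
        h.trans_le (Finset.single_le_sum (f := u) (fun k _ => hu k) hj)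
      rw [weightedEValue, flipSign_self, if_pos hle, mul_one, ← mul_div_assoc]
      have := hu j
      gcongr
  refine (Finset.sum_le_sum hval).trans ?_
  rw [← Finset.mul_sum, ← Finset.sum_div]
  exact mul_le_of_le_one_right (Nat.cast_nonneg p) (div_self_le_one _)

theorem measurable_countPos {t : (Fin p → ℝ) → ℝ} (ht : Measurable t) :
    Measurable fun w : Fin p → ℝ => (countPos w (t w) : ℝ) := by
  simp only [countPos, Finset.card_filter, Nat.cast_sum]
  refine Finset.measurable_sum _ fun k _ => ?_
  simp only [Nat.cast_ite, Nat.cast_one, Nat.cast_zero]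
  exact Measurable.ite (measurableSet_le ht (measurable_pi_apply k)) (by fun_prop) (by fun_prop)

theorem measurable_countNeg {t : (Fin p → ℝ) → ℝ} (ht : Measurable t) :
    Measurable fun w : Fin p → ℝ => (countNeg w (t w) : ℝ) := by
  simp only [countNeg, Finset.card_filter, Nat.cast_sum]
  refine Finset.measurable_sum _ fun k _ => ?_
  simp only [Nat.cast_ite, Nat.cast_one, Nat.cast_zero]
  exact Measurable.ite (measurableSet_le (measurable_pi_apply k) ht.neg) (by fun_prop)
    (by fun_prop)

theorem measurableSet_stopAt {t : (Fin p → ℝ) → ℝ} (ht : Measurable t) :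
    MeasurableSet {w : Fin p → ℝ | StopAt α w (t w)} := by
  have hP := measurable_countPos ht
  have hN := measurable_countNeg ht
  exact (measurableSet_lt measurable_const ht).inter
    ((measurableSet_le (hN.const_add 1) (hP.const_mul α)).union
      (measurableSet_lt hP measurable_const))

theorem measurableSet_knockoffThreshold_le {a : (Fin p → ℝ) → ℝ} (ha : Measurable a) :
    MeasurableSet {w : Fin p → ℝ | knockoffThreshold α w ≤ ((a w : ℝ) : WithTop ℝ)} := by
  simp only [knockoffThreshold_le_coe_iff, Set.ofPred_exists]
  refine MeasurableSet.iUnion fun i => ?_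
  have hi : Measurable fun w : Fin p → ℝ => |w i| := (measurable_pi_apply i).abs
  exact (measurableSet_stopAt hi).inter (measurableSet_le hi ha)

theorem measurable_weightedEValue (j : Fin p) :
    Measurable fun w => weightedEValue α u w j := by
  unfold weightedEValue
  have h (a : (Fin p → ℝ) → ℝ) (ha : Measurable a) : Measurable fun w : Fin p → ℝ =>
      if knockoffThreshold α w ≤ ((a w : ℝ) : WithTop ℝ) then (1 : ℝ) else 0 :=
    Measurable.ite (measurableSet_knockoffThreshold_le ha) measurable_const measurable_const
  exact ((h _ (measurable_pi_apply j)).const_mul _).div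
    ((Finset.measurable_sum _ fun k _ => (h _ (measurable_pi_apply k).neg).const_mul _).const_add _)

end Weighted

/-! ### Adaptive e-values: pointwise inequality and measurability -/

namespace ScreeningRule

variable {p : ℕ} (r : ScreeningRule p) (u : Fin p → ℝ) {α : ℝ} {w : Fin p → ℝ}

theorem screened_mono (w : Fin p → ℝ) : Monotone (r.screened u w) :=
  monotone_nat_of_le_succ fun _ => Finset.subset_insert _ _

theorem masked_flipSign {j : Fin p} {D : Finset (Fin p)} (hj : j ∉ D) :
    masked D (flipSign j w) = masked D w := by
  funext k
  unfold masked
  split_ifs with hk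
  · exact flipSign_of_ne (fun h => hj (by rwa [← h])) w
  · exact abs_flipSign j w k

/-- Until j is screened the rule sees only |w_j|, so its choices cannot depend on the sign. -/
theorem screened_flipSign {j : Fin p} {k : ℕ} (hj : j ∉ r.screened u w k) :
    r.screened u (flipSign j w) k = r.screened u w k := by
  induction k with
  | zero => rfl
  | succ k ih =>
    have hj' : j ∉ r.screened u w k := fun h => hj (r.screened_mono u w k.le_succ h)
    simp only [screened, ih hj', masked_flipSign hj']

theorem notMem_screened_of_flipSign {j : Fin p} {k : ℕ} (hj : j ∉ r.screened u (flipSign j w) k) :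
    j ∉ r.screened u w k := by
  have := r.screened_flipSign u hj
  rw [flipSign_flipSign] at this
  rwa [this]

theorem card_unscreenedPos_flipSign {j : Fin p} {k : ℕ} (hw : w j < 0)
    (hj : j ∉ r.screened u w k) :
    (r.unscreenedPos u (flipSign j w) k).card = (r.unscreenedPos u w k).card + 1 := by
  have h : r.unscreenedPos u (flipSign j w) k = insert j (r.unscreenedPos u w k) := by
    ext i
    simp only [unscreenedPos, Finset.mem_filter, Finset.mem_univ, true_and, Finset.mem_insert,
      r.screened_flipSign u hj]
    by_cases hi : i = j
    · subst hi; simp [hj, hw]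
    · simp [flipSign_of_ne hi, hi]
  rw [h, Finset.card_insert_of_notMem]
  simp [unscreenedPos, hw.le]

theorem card_unscreenedNeg_flipSign {j : Fin p} {k : ℕ} (hw : w j < 0)
    (hj : j ∉ r.screened u w k) :
    (r.unscreenedNeg u (flipSign j w) k).card + 1 = (r.unscreenedNeg u w k).card := by
  have h : r.unscreenedNeg u w k = insert j (r.unscreenedNeg u (flipSign j w) k) := by
    ext i
    simp only [unscreenedNeg, Finset.mem_filter, Finset.mem_univ, true_and, Finset.mem_insert,
      r.screened_flipSign u hj]
    by_cases hi : i = j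
    · subst hi; simp [hj, hw]
    · simp [flipSign_of_ne hi, hi]
  rw [h, Finset.card_insert_of_notMem]
  simp [unscreenedNeg, hw.le]

/-- The stopping condition of the adaptive procedure after `k` steps. -/
def StopAt (α : ℝ) (w : Fin p → ℝ) (k : ℕ) : Prop :=
  (1 + (r.unscreenedNeg u w k).card : ℝ) / (max (r.unscreenedPos u w k).card 1 : ℕ) ≤ α

theorem stoppingTime_le {k : ℕ} (hk : k ≤ p) (h : r.StopAt u α w k) :
    r.stoppingTime u w α ≤ k :=
  Finset.min_le (Finset.mem_filter.2 ⟨Finset.mem_range.2 (Nat.lt_succ_of_le hk), h⟩)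

theorem of_stoppingTime_eq {k : ℕ} (h : r.stoppingTime u w α = k) :
    k ≤ p ∧ r.StopAt u α w k := by
  obtain ⟨h1, h2⟩ := Finset.mem_filter.1 (Finset.mem_of_min h)
  exact ⟨Nat.lt_succ_iff.1 (Finset.mem_range.1 h1), h2⟩

theorem stoppingTime_eq_iff {k : ℕ} :
    r.stoppingTime u w α = k ↔
      k ≤ p ∧ r.StopAt u α w k ∧ ∀ l < k, ¬ r.StopAt u α w l := by
  constructor
  · intro h
    obtain ⟨h1, h2⟩ := r.of_stoppingTime_eq u h
    refine ⟨h1, h2, fun l hl hs => ?_⟩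
    have := r.stoppingTime_le u (hl.le.trans h1) hs
    rw [h] at this
    exact absurd (WithTop.coe_le_coe.1 this) (not_le.2 hl)
  · rintro ⟨h1, h2, h3⟩
    have hle := r.stoppingTime_le u h1 h2
    obtain ⟨l, hl⟩ := WithTop.ne_top_iff_exists.1 (ne_top_of_le_ne_top WithTop.coe_ne_top hle)
    have hs := (r.of_stoppingTime_eq u hl.symm).2
    rw [← hl] at hle ⊢
    have hlk : l ≤ k := WithTop.coe_le_coe.1 hle
    rcases hlk.eq_or_lt with h | h
    · rw [h]
      rfl
    · exact absurd hs (h3 l h)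

/-- With i and j both unscreened and negative at step k, either flip leaves the screening path
unchanged up to k and shifts |P(k)| and |N(k)| equally. -/
theorem stoppingTime_flipSign_le {i j : Fin p} {k : ℕ} (h : r.stoppingTime u (flipSign i w) α = k)
    (hi : w i < 0) (hj : w j < 0) (hik : i ∉ r.screened u w k) (hjk : j ∉ r.screened u w k) :
    r.stoppingTime u (flipSign j w) α ≤ k := by
  obtain ⟨hk, hs⟩ := r.of_stoppingTime_eq u h
  refine r.stoppingTime_le u hk ?_
  have hN : (r.unscreenedNeg u (flipSign j w) k).card =
      (r.unscreenedNeg u (flipSign i w) k).card := by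
    have h1 := r.card_unscreenedNeg_flipSign u hi hik
    have h2 := r.card_unscreenedNeg_flipSign u hj hjk
    omega
  have hP : (r.unscreenedPos u (flipSign j w) k).card =
      (r.unscreenedPos u (flipSign i w) k).card := by
    rw [r.card_unscreenedPos_flipSign u hi hik, r.card_unscreenedPos_flipSign u hj hjk]
  rwa [StopAt, hN, hP]

theorem stoppingTime_flipSign_eq {i j : Fin p} {k l : ℕ}
    (hk : r.stoppingTime u (flipSign i w) α = k)
    (hl : r.stoppingTime u (flipSign j w) α = l)
    (hi : w i < 0) (hj : w j < 0) (hik : i ∉ r.screened u w k) (hjl : j ∉ r.screened u w l) :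
    k = l := by
  rcases le_total k l with h | h
  · have := r.stoppingTime_flipSign_le u hk hi hj hik fun hm => hjl (r.screened_mono u w h hm)
    rw [hl] at this
    exact le_antisymm h (WithTop.coe_le_coe.1 this)
  · have := r.stoppingTime_flipSign_le u hl hj hi hjl fun hm => hik (r.screened_mono u w h hm)
    rw [hk] at this
    exact le_antisymm (WithTop.coe_le_coe.1 this) h

theorem eValue_nonneg (j : Fin p) : 0 ≤ r.eValue u w α j := by
  unfold eValue
  split
  · exact le_rfl
  · split_ifs <;> positivity

theorem eValue_of_stoppingTime_eq {k : ℕ} (h : r.stoppingTime u w α = k) (j : Fin p) :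
    r.eValue u w α j = ((p : ℝ) * if j ∈ r.unscreenedPos u w k then 1 else 0) /
      (1 + (r.unscreenedNeg u w k).card : ℝ) := by
  simp only [eValue, h]
  rfl

theorem exists_of_eValue_ne_zero {j : Fin p} (h : r.eValue u w α j ≠ 0) :
    ∃ k : ℕ, r.stoppingTime u w α = k ∧ j ∈ r.unscreenedPos u w k := by
  cases hT : r.stoppingTime u w α with
  | top => simp [eValue, hT] at h
  | coe k =>
    refine ⟨k, rfl, by_contra fun hj => h ?_⟩
    rw [r.eValue_of_stoppingTime_eq u hT, if_neg hj, mul_zero, zero_div]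

theorem sum_eValue_flipSign_le : ∑ j, r.eValue u (flipSign j w) α j ≤ p := by
  classical
  set J : Finset (Fin p) := Finset.univ.filter fun j => r.eValue u (flipSign j w) α j ≠ 0
  have hJ : ∀ j ∈ J, ∃ k : ℕ, r.stoppingTime u (flipSign j w) α = k ∧ w j < 0 ∧
      j ∉ r.screened u w k := by
    intro j hj
    obtain ⟨k, hk, hjk⟩ := r.exists_of_eValue_ne_zero u (Finset.mem_filter.1 hj).2
    simp only [unscreenedPos, Finset.mem_filter, Finset.mem_univ, true_and, flipSign_self,
      Left.neg_pos_iff] at hjk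
    exact ⟨k, hk, hjk.2, r.notMem_screened_of_flipSign u hjk.1⟩
  have hsum : ∑ j, r.eValue u (flipSign j w) α j = ∑ j ∈ J, r.eValue u (flipSign j w) α j :=
    (Finset.sum_filter_ne_zero _).symm
  rw [hsum]
  rcases J.eq_empty_or_nonempty with h0 | ⟨i, hi⟩
  · simp [h0]
  obtain ⟨k, hk, hwi, hik⟩ := hJ i hi
  have hall : ∀ j ∈ J, r.stoppingTime u (flipSign j w) α = k ∧ w j < 0 ∧ j ∉ r.screened u w k := by
    intro j hj
    obtain ⟨l, hl, hwj, hjl⟩ := hJ j hj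
    obtain rfl := r.stoppingTime_flipSign_eq u hk hl hwi hwj hik hjl
    exact ⟨hl, hwj, hjl⟩
  have hcard : J.card ≤ (r.unscreenedNeg u w k).card := Finset.card_le_card fun j hj => by
    obtain ⟨-, hwj, hjk⟩ := hall j hj
    simp [unscreenedNeg, hwj, hjk]
  have hJpos : 0 < J.card := Finset.card_pos.2 ⟨i, hi⟩
  have hNpos : (0 : ℝ) < (r.unscreenedNeg u w k).card := by exact_mod_cast hJpos.trans_le hcard
  -- The 1 in the denominator restores j, which the flip removed from N(k).
  have hval : ∀ j ∈ J, r.eValue u (flipSign j w) α j ≤ p / (r.unscreenedNeg u w k).card := by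
    intro j hj
    obtain ⟨hs, hwj, hjk⟩ := hall j hj
    rw [r.eValue_of_stoppingTime_eq u hs, ← r.card_unscreenedNeg_flipSign u hwj hjk, Nat.cast_add,
      Nat.cast_one, add_comm (1 : ℝ)]
    gcongr
    exact mul_le_of_le_one_right (Nat.cast_nonneg p) (by split_ifs <;> norm_num)
  refine (Finset.sum_le_card_nsmul _ _ _ hval).trans ?_
  rw [nsmul_eq_mul, mul_div_assoc', div_le_iff₀ hNpos, mul_comm]
  gcongr

theorem measurable_masked (D : Finset (Fin p)) : Measurable (masked D) := by
  refine measurable_pi_lambda _ fun j => ?_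
  unfold masked
  split_ifs
  · exact measurable_pi_apply j
  · exact (measurable_pi_apply j).abs

theorem measurableSet_screened_eq (k : ℕ) (D : Finset (Fin p)) :
    MeasurableSet {w | r.screened u w k = D} := by
  induction k generalizing D with
  | zero => simp only [screened]; exact MeasurableSet.const _
  | succ k ih =>
    -- Splitting over the finitely many previous sets D' lets the rule be evaluated at a fixed set,
    -- where it is measurable.
    have h : {w | r.screened u w (k + 1) = D} = ⋃ D', {w | r.screened u w k = D'} ∩
        {w | insert (r.next u D' (masked D' w)) D' = D} := by
      ext w
      simp [screened]
    rw [h]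
    refine MeasurableSet.iUnion fun D' => (ih D').inter ?_
    exact ((r.measurable_next u D').comp (measurable_masked D'))
      (MeasurableSet.of_discrete (s := {i | insert i D' = D}))

theorem measurableSet_notMem_screened (k : ℕ) (j : Fin p) :
    MeasurableSet {w | j ∉ r.screened u w k} := by
  have h : {w | j ∉ r.screened u w k} =
      ⋃ D : {D : Finset (Fin p) // j ∉ D}, {w | r.screened u w k = D} := by
    ext w
    simp
  rw [h]
  exact MeasurableSet.iUnion fun D => r.measurableSet_screened_eq u k D

theorem measurableSet_mem_unscreenedPos (k : ℕ) (j : Fin p) :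
    MeasurableSet {w | j ∈ r.unscreenedPos u w k} := by
  simp only [unscreenedPos, Finset.mem_filter, Finset.mem_univ, true_and]
  exact (r.measurableSet_notMem_screened u k j).inter
    (measurableSet_lt measurable_const (measurable_pi_apply j))

theorem measurable_card_unscreenedPos (k : ℕ) :
    Measurable fun w => ((r.unscreenedPos u w k).card : ℝ) := by
  simp only [unscreenedPos, Finset.card_filter, Nat.cast_sum, Nat.cast_ite, Nat.cast_one,
    Nat.cast_zero]
  exact Finset.measurable_sum _ fun j _ => Measurable.ite
    ((r.measurableSet_notMem_screened u k j).inter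
      (measurableSet_lt measurable_const (measurable_pi_apply j))) (by fun_prop) (by fun_prop)

theorem measurable_card_unscreenedNeg (k : ℕ) :
    Measurable fun w => ((r.unscreenedNeg u w k).card : ℝ) := by
  simp only [unscreenedNeg, Finset.card_filter, Nat.cast_sum, Nat.cast_ite, Nat.cast_one,
    Nat.cast_zero]
  exact Finset.measurable_sum _ fun j _ => Measurable.ite
    ((r.measurableSet_notMem_screened u k j).inter
      (measurableSet_lt (measurable_pi_apply j) measurable_const)) (by fun_prop) (by fun_prop)

theorem measurableSet_stopAt (k : ℕ) : MeasurableSet {w | r.StopAt u α w k} := by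
  unfold StopAt
  simp only [Nat.cast_max, Nat.cast_one]
  exact measurableSet_le (((r.measurable_card_unscreenedNeg u k).const_add 1).div
    ((r.measurable_card_unscreenedPos u k).max measurable_const)) measurable_const

theorem measurableSet_stoppingTime_eq (k : ℕ) :
    MeasurableSet {w | r.stoppingTime u w α = k} := by
  simp only [stoppingTime_eq_iff]
  refine (MeasurableSet.const _).inter ((r.measurableSet_stopAt u k).inter ?_)
  change MeasurableSet {w | ∀ l < k, ¬ r.StopAt u α w l}
  have h : {w | ∀ l < k, ¬ r.StopAt u α w l} = ⋂ l : Fin k, {w | r.StopAt u α w l}ᶜ := by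
    ext w
    simp [Fin.forall_iff]
  rw [h]
  exact MeasurableSet.iInter fun l => (r.measurableSet_stopAt u l).compl

theorem measurable_eValue (j : Fin p) : Measurable fun w => r.eValue u w α j := by
  classical
  have h : (fun w => r.eValue u w α j) = fun w => ∑ k ∈ Finset.range (p + 1),
      if r.stoppingTime u w α = k then ((p : ℝ) * if j ∈ r.unscreenedPos u w k then 1 else 0) /
        (1 + (r.unscreenedNeg u w k).card : ℝ) else 0 := by
    funext w
    cases hT : r.stoppingTime u w α with
    | top => simp [eValue, hT]
    | coe k =>
      have hk := (r.of_stoppingTime_eq u hT).1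
      rw [r.eValue_of_stoppingTime_eq u hT, Finset.sum_eq_single k]
      · exact (if_pos rfl).symm
      · intro l _ hl
        exact if_neg fun h => hl (WithTop.coe_injective h).symm
      · intro h
        exact absurd (Finset.mem_range.2 (Nat.lt_succ_of_le hk)) h
  rw [h]
  refine Finset.measurable_sum _ fun k _ =>
    Measurable.ite (r.measurableSet_stoppingTime_eq u k) ?_ measurable_const
  exact ((Measurable.ite (r.measurableSet_mem_unscreenedPos u k j) measurable_const
    measurable_const).const_mul _).div ((r.measurable_card_unscreenedNeg u k).const_add 1)

end ScreeningRule

/-! ### Products of kernels -/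

section ProductKernel

variable {A B : Type*} [MeasurableSpace A] [MeasurableSpace B]

/-- The kernel drawing the `n` coordinates independently, the `i`-th one from `K (x i)`. -/
noncomputable def piKernel (n : ℕ) (K : Kernel A B) [IsMarkovKernel K] :
    Kernel (Fin n → A) (Fin n → B) where
  toFun x := Measure.pi fun i => K (x i)
  measurable' := by
    refine Measurable.measure_of_isPiSystem_of_isProbabilityMeasure
      generateFrom_pi.symm isPiSystem_pi ?_
    rintro _ ⟨s, hs, rfl⟩
    simp only [Measure.pi_pi]
    exact Finset.measurable_prod _ fun i _ =>
      (K.measurable_coe (hs i (Set.mem_univ i))).comp (measurable_pi_apply i)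

theorem piKernel_apply (n : ℕ) (K : Kernel A B) [IsMarkovKernel K] (x : Fin n → A) :
    piKernel n K x = Measure.pi fun i => K (x i) := rfl

instance (n : ℕ) (K : Kernel A B) [IsMarkovKernel K] : IsMarkovKernel (piKernel n K) :=
  ⟨fun x => by rw [piKernel_apply]; infer_instance⟩

/-- A product of composition-products is the composition-product of the products. -/
theorem pi_compProd (n : ℕ) (μ : Measure A) [IsProbabilityMeasure μ] (K : Kernel A B)
    [IsMarkovKernel K] :
    Measure.pi (fun _ : Fin n => μ ⊗ₘ K) =
      ((Measure.pi fun _ : Fin n => μ) ⊗ₘ piKernel n K).map fun a i => (a.1 i, a.2 i) := by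
  refine Measure.pi_eq fun s hs => ?_
  have hmeas : Measurable fun (a : (Fin n → A) × (Fin n → B)) i => (a.1 i, a.2 i) := by fun_prop
  rw [Measure.map_apply hmeas (MeasurableSet.univ_pi hs),
    Measure.compProd_apply (hmeas (MeasurableSet.univ_pi hs))]
  have hsec (x : Fin n → A) : piKernel n K x (Prod.mk x ⁻¹'
      ((fun (a : (Fin n → A) × (Fin n → B)) i => (a.1 i, a.2 i)) ⁻¹' Set.univ.pi s)) =
      ∏ i, K (x i) (Prod.mk (x i) ⁻¹' s i) := by
    rw [piKernel_apply, ← Measure.pi_pi]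
    congr 1
  have hK (i : Fin n) : Measurable fun a => K a (Prod.mk a ⁻¹' s i) :=
    Kernel.measurable_kernel_prodMk_left (hs i)
  simp_rw [hsec]
  -- On a box the integrand is a product of functions of separate coordinates, which are independent
  -- under the product measure.
  rw [lintegral_prod_eq_prod_lintegral_of_indepFun Finset.univ
    (fun i (x : Fin n → A) => K (x i) (Prod.mk (x i) ⁻¹' s i))
    (iIndepFun_pi fun i => (hK i).aemeasurable)
    fun i => (hK i).comp (measurable_pi_apply i)]
  refine Finset.prod_congr rfl fun i _ => ?_
  rw [Measure.compProd_apply (hs i)]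
  exact (measurePreserving_eval (fun _ : Fin n => μ) i).lintegral_comp (hK i)

end ProductKernel

/-! ### Conditional law of the response at a null feature -/

section NullFeature

variable {p : ℕ} (P : Measure ((Fin p → ℝ) × ℝ)) [IsProbabilityMeasure P]

/-- The vector with `j`-th coordinate `a.2` and other coordinates `a.1`. -/
def insertCoord (j : Fin p) (a : ({k : Fin p // k ≠ j} → ℝ) × ℝ) : Fin p → ℝ :=
  fun k => if h : k = j then a.2 else a.1 ⟨k, h⟩

theorem measurable_insertCoord (j : Fin p) : Measurable (insertCoord j) := by
  refine measurable_pi_lambda _ fun k => ?_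
  unfold insertCoord
  split_ifs <;> fun_prop

theorem insertCoord_covariatesExcept (j : Fin p) (z : (Fin p → ℝ) × ℝ) :
    insertCoord j (covariatesExcept j z, z.1 j) = z.1 := by
  funext k
  unfold insertCoord covariatesExcept
  split_ifs with h
  · rw [h]
  · rfl

/-- Under the null hypothesis `H_j` the response is drawn from a kernel that does not depend on
the `j`-th covariate. -/
theorem IsNull.exists_kernel {j : Fin p} (hj : IsNull P j) :
    ∃ (Q : Kernel (Fin p → ℝ) ℝ) (_ : IsMarkovKernel Q),
      P = P.map Prod.fst ⊗ₘ Q ∧ ∀ x x' : Fin p → ℝ, (∀ k ≠ j, x k = x' k) → Q x = Q x' := by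
  have hk := measurable_covariatesExcept j
  have hg : Measurable fun z : (Fin p → ℝ) × ℝ => z.1 j := by fun_prop
  have hci := (condIndepFun_iff_condDistrib_prod_ae_eq_prodMkRight (μ := P) measurable_snd hg
    hk).1 (CondIndepFun.symm hj)
  rw [condDistrib_ae_eq_iff_measure_eq_compProd _ measurable_snd.aemeasurable] at hci
  set S := condDistrib (fun z : (Fin p → ℝ) × ℝ => z.2) (covariatesExcept j) P
  have hres : Measurable fun (x : Fin p → ℝ) (k : {k : Fin p // k ≠ j}) => x k := by fun_prop
  -- Q forgets the j-th coordinate and applies the conditional law of Y given X_{-j}. Its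
  -- independence of x_j thus holds at every point, not merely almost everywhere.
  refine ⟨S.comap _ hres, inferInstance, ?_, fun x x' h => ?_⟩
  · refine Measure.ext_of_lintegral _ fun f hf => ?_
    have hins := measurable_insertCoord j
    have hf' : Measurable fun b : (({k : Fin p // k ≠ j} → ℝ) × ℝ) × ℝ =>
        f (insertCoord j b.1, b.2) := by fun_prop
    have hmk : Measurable fun z : (Fin p → ℝ) × ℝ => (covariatesExcept j z, z.1 j) := by fun_prop
    calc ∫⁻ z, f z ∂P
        = ∫⁻ b, f (insertCoord j b.1, b.2)
            ∂P.map fun z => ((covariatesExcept j z, z.1 j), z.2) := by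
          rw [lintegral_map hf' (by fun_prop)]
          simp only [insertCoord_covariatesExcept]
      _ = ∫⁻ z, (∫⁻ y, f (z.1, y) ∂S (covariatesExcept j z)) ∂P := by
          rw [hci, Measure.lintegral_compProd hf',
            lintegral_map hf'.lintegral_kernel_prod_right' hmk]
          simp only [insertCoord_covariatesExcept, Kernel.prodMkRight_apply]
      _ = _ := by
          rw [Measure.lintegral_compProd hf,
            lintegral_map hf.lintegral_kernel_prod_right' measurable_fst]
          rfl
  · rw [Kernel.comap_apply, Kernel.comap_apply]
    congr 1
    funext k
    exact h k k.2

end NullFeature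

/-! ### Swap invariance and sign symmetry -/

section Exchangeability

variable {n p M : ℕ} {P : Measure ((Fin p → ℝ) × ℝ)} [IsProbabilityMeasure P]
  {κ : Kernel (Design n p) (Design n p)} [IsMarkovKernel κ]

theorem Data.measurable_Y : Measurable (Data.Y : Data n p → Fin n → ℝ) := by
  unfold Data.Y
  fun_prop

theorem measurable_swapColumn (j : Fin p) :
    Measurable (swapColumn j : Design n p × Design n p → _) := by
  unfold swapColumn
  refine Measurable.prodMk ?_ ?_ <;>
  · refine measurable_pi_lambda _ fun i => measurable_pi_lambda _ fun k => ?_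
    split_ifs <;> fun_prop

instance : IsProbabilityMeasure (dataLaw n P) := by unfold dataLaw; infer_instance

instance : IsMarkovKernel (knockoffCopies M κ) :=
  ⟨fun x => inferInstanceAs (IsProbabilityMeasure (Measure.pi fun _ : Fin M => κ x))⟩

theorem map_X_dataLaw :
    (dataLaw n P).map Data.X = Measure.pi fun _ : Fin n => P.map Prod.fst := by
  have : IsProbabilityMeasure (P.map Prod.fst) :=
    Measure.isProbabilityMeasure_map measurable_fst.aemeasurable
  exact Measure.pi_map_pi (μ := fun _ : Fin n => P) (f := fun _ => Prod.fst)
    fun _ => measurable_fst.aemeasurable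

theorem lintegral_dataLaw {Q : Kernel (Fin p → ℝ) ℝ} [IsMarkovKernel Q]
    (hQ : P = P.map Prod.fst ⊗ₘ Q) {f : Design n p × (Fin n → ℝ) → ℝ≥0∞} (hf : Measurable f) :
    ∫⁻ d, f (d.X, d.Y) ∂dataLaw n P =
      ∫⁻ x, ∫⁻ y, f (x, y) ∂piKernel n Q x ∂(dataLaw n P).map Data.X := by
  have : IsProbabilityMeasure (P.map Prod.fst) :=
    Measure.isProbabilityMeasure_map measurable_fst.aemeasurable
  have hX := Data.measurable_X (n := n) (p := p)
  have hY := Data.measurable_Y (n := n) (p := p)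
  rw [map_X_dataLaw, ← Measure.lintegral_compProd hf]
  conv_lhs => rw [dataLaw, hQ, pi_compProd]
  exact lintegral_map (hf.comp (hX.prodMk hY)) (by fun_prop)

theorem lintegral_experimentLaw_single (m : Fin M)
    {f : (Design n p × Design n p) × (Fin n → ℝ) → ℝ≥0∞} (hf : Measurable f) :
    ∫⁻ ω, f ((ω.1.X, ω.2 m), ω.1.Y) ∂experimentLaw n M P κ =
      ∫⁻ d, ∫⁻ x', f ((d.X, x'), d.Y) ∂κ d.X ∂dataLaw n P := by
  have hX := Data.measurable_X (n := n) (p := p)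
  have hY := Data.measurable_Y (n := n) (p := p)
  have hfm : Measurable fun ω : Data n p × (Fin M → Design n p) =>
      f ((ω.1.X, ω.2 m), ω.1.Y) := by fun_prop
  rw [experimentLaw, Measure.lintegral_compProd hfm]
  refine lintegral_congr fun d => ?_
  have hfd : Measurable fun x' : Design n p => f ((d.X, x'), d.Y) := by fun_prop
  exact (measurePreserving_eval (fun _ : Fin M => κ d.X) m).lintegral_comp hfd

/-- Given X, the response and the knockoff are independent, so by Tonelli the pair (X, X̃) may be
drawn first and Y afterwards from X alone. Exchangeability of the pair then applies directly. -/
theorem lintegral_experimentLaw_eq {Q : Kernel (Fin p → ℝ) ℝ} [IsMarkovKernel Q]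
    (hQ : P = P.map Prod.fst ⊗ₘ Q) (m : Fin M)
    {f : (Design n p × Design n p) × (Fin n → ℝ) → ℝ≥0∞} (hf : Measurable f) :
    ∫⁻ ω, f ((ω.1.X, ω.2 m), ω.1.Y) ∂experimentLaw n M P κ =
      ∫⁻ A, ∫⁻ y, f (A, y) ∂piKernel n Q A.1 ∂((dataLaw n P).map Data.X ⊗ₘ κ) := by
  have : IsProbabilityMeasure ((dataLaw n P).map Data.X) :=
    Measure.isProbabilityMeasure_map Data.measurable_X.aemeasurable
  have h1 : Measurable fun b : Design n p × (Fin n → ℝ) =>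
      ∫⁻ x', f ((b.1, x'), b.2) ∂κ b.1 := by
    have : Measurable fun c : (Design n p × (Fin n → ℝ)) × Design n p =>
      f ((c.1.1, c.2), c.1.2) := by fun_prop
    exact this.lintegral_kernel_prod_right' (κ := κ.comap Prod.fst measurable_fst)
  have h2 : Measurable fun A : Design n p × Design n p => ∫⁻ y, f (A, y) ∂piKernel n Q A.1 :=
    hf.lintegral_kernel_prod_right' (κ := (piKernel n Q).comap Prod.fst measurable_fst)
  rw [lintegral_experimentLaw_single m hf, lintegral_dataLaw hQ h1,
    Measure.lintegral_compProd h2]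
  refine lintegral_congr fun x => ?_
  have hfx : Measurable fun b : (Fin n → ℝ) × Design n p => f ((x, b.2), b.1) := by fun_prop
  exact lintegral_lintegral_swap (μ := piKernel n Q x) (ν := κ x)
    (f := fun y x' => f ((x, x'), y)) hfx.aemeasurable

/-- The joint law of `([𝐗, 𝐗̃], 𝐘)` is invariant under exchanging the columns of a null feature. -/
theorem lintegral_experimentLaw_swapColumn
    (hκ : PairwiseExchangeable ((dataLaw n P).map Data.X) κ) {j : Fin p} (hj : IsNull P j)
    (m : Fin M) {f : (Design n p × Design n p) × (Fin n → ℝ) → ℝ≥0∞} (hf : Measurable f) :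
    ∫⁻ ω, f (swapColumn j (ω.1.X, ω.2 m), ω.1.Y) ∂experimentLaw n M P κ =
      ∫⁻ ω, f ((ω.1.X, ω.2 m), ω.1.Y) ∂experimentLaw n M P κ := by
  obtain ⟨Q, _, hQ, hQj⟩ := hj.exists_kernel P
  have hsw := measurable_swapColumn (n := n) j
  have hfs : Measurable fun b : (Design n p × Design n p) × (Fin n → ℝ) =>
      f (swapColumn j b.1, b.2) := by fun_prop
  have h2 : Measurable fun A : Design n p × Design n p => ∫⁻ y, f (A, y) ∂piKernel n Q A.1 :=
    hf.lintegral_kernel_prod_right' (κ := (piKernel n Q).comap Prod.fst measurable_fst)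
  rw [lintegral_experimentLaw_eq hQ m hfs, lintegral_experimentLaw_eq hQ m hf]
  -- After this change of variables the two sides differ only in the conditional law of Y, which
  -- ignores column j of each row.
  conv_rhs => rw [← hκ j, lintegral_map h2 hsw]
  refine lintegral_congr fun A => ?_
  have hA : piKernel n Q (swapColumn j A).1 = piKernel n Q A.1 := by
    rw [piKernel_apply, piKernel_apply]
    congr 1
    funext i
    exact hQj _ _ fun k hk => by simp [swapColumn, hk]
  rw [hA]

theorem ImportanceRule.stat_swapColumn_eq_flipSign (𝒲 : ImportanceRule n p) (j : Fin p)
    (A : Design n p × Design n p) (y : Fin n → ℝ) :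
    𝒲.stat (swapColumn j A) y = flipSign j (𝒲.stat A y) :=
  funext fun k => 𝒲.stat_swapColumn j A y k

theorem ImportanceRule.measurable_run (𝒲 : ImportanceRule n p) (m : Fin M) :
    Measurable fun ω : Data n p × (Fin M → Design n p) => 𝒲.run ω m := by
  have hX := Data.measurable_X (n := n) (p := p)
  have hY := Data.measurable_Y (n := n) (p := p)
  have h : Measurable fun ω : Data n p × (Fin M → Design n p) =>
      ((ω.1.X, ω.2 m), ω.1.Y) := by fun_prop
  exact 𝒲.measurable_stat.comp h

/-- The sign of the statistic of a null feature is symmetric given everything else. -/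
theorem lintegral_run_flipSign (hκ : PairwiseExchangeable ((dataLaw n P).map Data.X) κ)
    (𝒲 : ImportanceRule n p) {j : Fin p} (hj : IsNull P j) (m : Fin M)
    {f : (Fin p → ℝ) → ℝ≥0∞} (hf : Measurable f) :
    ∫⁻ ω, f (𝒲.run ω m) ∂experimentLaw n M P κ =
      ∫⁻ ω, f (flipSign j (𝒲.run ω m)) ∂experimentLaw n M P κ := by
  have h := lintegral_experimentLaw_swapColumn hκ hj m (hf.comp 𝒲.measurable_stat)
  simp only [Function.comp_def, 𝒲.stat_swapColumn_eq_flipSign] at h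
  exact h.symm

end Exchangeability

/-! ### From the pointwise inequality to FDR control -/

section FDR

variable {n p M : ℕ} {P : Measure ((Fin p → ℝ) × ℝ)} [IsProbabilityMeasure P]
  {κ : Kernel (Design n p) (Design n p)} [IsMarkovKernel κ]

instance : IsProbabilityMeasure (experimentLaw n M P κ) := by
  unfold experimentLaw; infer_instance

/-- Each null gets its own flip, after which the sum goes inside a single integral; nonnegativity
extends it to all features, where `hsum` applies pointwise. -/
theorem sum_lintegral_eval_le (hκ : PairwiseExchangeable ((dataLaw n P).map Data.X) κ)
    (𝒲 : ImportanceRule n p) {eval : (Fin p → ℝ) → Fin p → ℝ}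
    (hmeas : ∀ j, Measurable fun w => eval w j) (hnn : ∀ w j, 0 ≤ eval w j)
    (hsum : ∀ w, ∑ j, eval (flipSign j w) j ≤ p) (m : Fin M) :
    ∑ j ∈ nulls P, ∫⁻ ω, ENNReal.ofReal (eval (𝒲.run ω m) j) ∂experimentLaw n M P κ ≤ p := by
  have hflipSign : ∀ j ∈ nulls P,
      ∫⁻ ω, ENNReal.ofReal (eval (𝒲.run ω m) j) ∂experimentLaw n M P κ =
      ∫⁻ ω, ENNReal.ofReal (eval (flipSign j (𝒲.run ω m)) j) ∂experimentLaw n M P κ := by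
    intro j hj
    have hj' : IsNull P j := by simpa [nulls] using hj
    exact lintegral_run_flipSign hκ 𝒲 hj' m (hmeas j).ennreal_ofReal
  rw [Finset.sum_congr rfl hflipSign, ← lintegral_finsetSum]
  · calc _ ≤ ∫⁻ _, (p : ℝ≥0∞) ∂experimentLaw n M P κ := by
          refine lintegral_mono fun ω => ?_
          rw [← ENNReal.ofReal_sum_of_nonneg fun j _ => hnn _ j, ← ENNReal.ofReal_natCast]
          exact ENNReal.ofReal_le_ofReal ((Finset.sum_le_sum_of_subset_of_nonneg
            (Finset.subset_univ _) fun j _ _ => hnn _ j).trans (hsum _))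
      _ = p := by simp
  · intro j _
    exact ((hmeas j).comp ((measurable_flipSign j).comp (𝒲.measurable_run m))).ennreal_ofReal

/-- FDR control of derandomized e-BH for e-values whose sum stays below `p` when each one is
evaluated after flipping the sign of its own statistic. -/
theorem fdr_derandomizedSelect_le (hM : 1 ≤ M)
    (hκ : PairwiseExchangeable ((dataLaw n P).map Data.X) κ) (𝒲 : ImportanceRule n p)
    {eval : (Fin p → ℝ) → Fin p → ℝ}
    (hmeas : ∀ j, Measurable fun w => eval w j) (hnn : ∀ w j, 0 ≤ eval w j)
    (hsum : ∀ w, ∑ j, eval (flipSign j w) j ≤ p) {α : ℝ} (hα : 0 < α) :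
    fdr (experimentLaw n M P κ) (derandomizedSelect α 𝒲 eval) (nulls P) ≤ ENNReal.ofReal α := by
  have hMr : (0 : ℝ) < M := by exact_mod_cast hM
  have hm (m : Fin M) (j : Fin p) : Measurable fun ω : Data n p × (Fin M → Design n p) =>
      ENNReal.ofReal (eval (𝒲.run ω m) j) :=
    ((hmeas j).comp (𝒲.measurable_run m)).ennreal_ofReal
  have hpt (ω : Data n p × (Fin M → Design n p)) :
      ENNReal.ofReal (fdp (derandomizedSelect α 𝒲 eval ω) (nulls P)) ≤
        ENNReal.ofReal (α / p / M) *
          ∑ m : Fin M, ∑ j ∈ nulls P, ENNReal.ofReal (eval (𝒲.run ω m) j) := by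
    have h := fdp_ebhSelect_le hα (fun j => (1 / (M : ℝ)) * ∑ m : Fin M, eval (𝒲.run ω m) j)
      (fun j => mul_nonneg (by positivity) (Finset.sum_nonneg fun m _ => hnn _ j)) (nulls P)
    simp only [← ENNReal.ofReal_sum_of_nonneg fun j _ => hnn _ j]
    rw [← ENNReal.ofReal_sum_of_nonneg fun m _ => Finset.sum_nonneg fun j _ => hnn _ j,
      ← ENNReal.ofReal_mul (by positivity)]
    refine ENNReal.ofReal_le_ofReal (h.trans_eq ?_)
    rw [← Finset.mul_sum, Finset.sum_comm]
    ring
  calc fdr (experimentLaw n M P κ) (derandomizedSelect α 𝒲 eval) (nulls P)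
      ≤ ∫⁻ ω, ENNReal.ofReal (α / p / M) *
          ∑ m : Fin M, ∑ j ∈ nulls P, ENNReal.ofReal (eval (𝒲.run ω m) j)
            ∂experimentLaw n M P κ := lintegral_mono hpt
    _ = ENNReal.ofReal (α / p / M) * ∑ m : Fin M, ∑ j ∈ nulls P,
          ∫⁻ ω, ENNReal.ofReal (eval (𝒲.run ω m) j) ∂experimentLaw n M P κ := by
        rw [lintegral_const_mul _ (by fun_prop), lintegral_finsetSum _ (by fun_prop)]
        congr 1
        exact Finset.sum_congr rfl fun m _ => lintegral_finsetSum _ fun j _ => hm m j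
    _ ≤ ENNReal.ofReal (α / p / M) * ∑ _m : Fin M, (p : ℝ≥0∞) := by
        gcongr with m _
        exact sum_lintegral_eval_le hκ 𝒲 hmeas hnn hsum m
    _ ≤ ENNReal.ofReal α := by
        rw [Finset.sum_const, Finset.card_univ, Fintype.card_fin, nsmul_eq_mul,
          ← ENNReal.ofReal_natCast, ← ENNReal.ofReal_natCast (n := p),
          ← ENNReal.ofReal_mul hMr.le, ← ENNReal.ofReal_mul (by positivity)]
        refine ENNReal.ofReal_le_ofReal ?_
        -- For p = 0 the left side is 0; otherwise the factors p and M cancel.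
        rcases (Nat.cast_nonneg (α := ℝ) p).eq_or_lt with hp | hp
        · simp [← hp, hα.le]
        · apply le_of_eq
          field_simp

end FDR

end DerandKnockoffs

theorem theoremA4 {n p M : ℕ} (hM : 1 ≤ M)
    (P : Measure ((Fin p → ℝ) × ℝ)) [IsProbabilityMeasure P]
    (κ : ProbabilityTheory.Kernel (Design n p) (Design n p)) [IsMarkovKernel κ]
    (hκ : PairwiseExchangeable ((dataLaw n P).map Data.X) κ)
    (𝒲 : ImportanceRule n p)
    (u : Fin p → ℝ) (hu : ∀ j, 0 ≤ u j)
    (αkn αebh : ℝ) (hkn : αkn ∈ Set.Ioo (0 : ℝ) 1) (hebh : αebh ∈ Set.Ioo (0 : ℝ) 1) :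
    fdr (experimentLaw n M P κ)
        (derandomizedSelect αebh 𝒲 (weightedEValue αkn u)) (nulls P)
      ≤ ENNReal.ofReal αebh ∧
    ∀ r : ScreeningRule p,
      fdr (experimentLaw n M P κ)
          (derandomizedSelect αebh 𝒲 (fun w j => r.eValue u w αkn j)) (nulls P)
        ≤ ENNReal.ofReal αebh := by
  refine ⟨fdr_derandomizedSelect_le hM hκ 𝒲 measurable_weightedEValue
    (fun _ => weightedEValue_nonneg hu) (fun _ => sum_weightedEValue_flipSign_le hu) hebh.1,
    fun r => fdr_derandomizedSelect_le hM hκ 𝒲 (r.measurable_eValue u)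
      (fun _ => r.eValue_nonneg u) (fun _ => r.sum_eValue_flipSign_le u) hebh.1⟩
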